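/- Let $E$ be a metrizable Radon space (every finite Borel measure on $E$ is inner regular with respect to compact sets), let $E_\Delta=E\cup\{\Delta\}$ with $\Delta$ an isolated point, and let $\mathbb X=(\Omega,\mathcal G,(\mathcal G_t)_{t\ge0},(X_t)_{t\ge 0},(P_x)_{x\in E_\Delta})$ be a right Markov process on $E$: $X$ is an adapted $E_\Delta$-valued process with right-continuous paths, absorbed at $\Delta$; $(t,\omega)\mapsto X_t(\omega)$ is measurable with respect to $\mathcal B([0,\infty))\otimes\sigma(X_s,\,s\ge 0)$; $(\mathcal G_t)$ is right-continuous; $P_x(X_0=x)=1$ for $x\in E_\Delta$; $x\mapsto P_x(X_t\in B)$ is Borel on $E$ for all $t\ge0$ and Borel $B\subset E$; and $X$ has the strong Markov property with respect to $(\mathcal G_t)$. For $\alpha>0$ and Borel $f:E\to[0,\infty]$ (with $f(\Delta)=0$) put $$R_\alpha f(x)=E_x\int_0^\infty e^{-\alpha t}f(X_t)\,dt,\qquad R_\alpha(x,B)=R_\alpha \mathbf 1_B(x),\qquad x\in E,$$ and let $\mathcal B_1=\{u:E\to[0,1] \text{ Borel}\}$. We say that $(\mathbb X,\mathcal B_1)$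 has the compactness property if for every sequence $(u_n)\subset\mathcal B_1$ there are a set $\Lambda\subset(0,\infty)$ with $\sup\Lambda=\infty$ and a subsequence $(n')$ such that for every $\alpha\in\Lambda$ the sequence $(R_\alpha u_{n'}(x))$ converges to a finite limit for every $x\in E$. We say that $\mathbb X$ satisfies Meyer's hypothesis (L) if it has a reference measure, i.e. a $\sigma$-finite Borel measure $m$ on $E$ such that for some $\alpha>0$, $R_\alpha(x,\cdot)\ll m$ for every $x\in E$. Then: 1. if $E$ is an analytic (Suslin) space, i.e. empty or a continuous image of $\mathbb N^{\mathbb N}$ (in particular if $E$ is homeomorphic to a Borel subset of a Polish space), then $(\mathbb X,\mathcal B_1)$ has the compactness property if and only if $\mathbb X$ satisfies hypothesis (L); 2. for every metrizable Radon space $E$, hypothesis (L) implies that $(\mathbb X,\mathcal B_1)$ has the compactness property. -/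

import Mathlib

open MeasureTheory Set Filter Topology
open scoped NNReal ENNReal

universe u v

/-- A Radon space: every finite Borel measure is inner regular with respect to compact sets.
For a separable metrizable space this says that the space is homeomorphic to a universally
measurable subset of a compact metrizable space. -/
def IsRadonSpace (E : Type u) [TopologicalSpace E] [MeasurableSpace E] : Prop :=
  ∀ μ : Measure E, IsFiniteMeasure μ → μ.InnerRegular

/-- The state space `E_Δ = E ∪ {Δ}` with the cemetery `Δ` adjoined as an isolated point
(disjoint union topology and disjoint union `σ`-algebra). -/
abbrev WithCemetery (E : Type u) : Type u := E ⊕ Unit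

/-- The cemetery point `Δ`. -/
abbrev cemetery (E : Type u) : WithCemetery E := Sum.inr ()

/-- A normal process on `E`: an `E_Δ`-valued process on `(Ω, 𝒢)` adapted to a filtration, absorbed
at `Δ`, with a family of probability measures `P x`, `x ∈ E_Δ`. The Markov property is not part
of the definition. By convention `X_∞ = Δ`, so that only finite times are recorded. -/
structure NormalProcess (E : Type u) [MeasurableSpace E]
    (Ω : Type v) [mΩ : MeasurableSpace Ω] where
  /-- the process -/
  X : ℝ≥0 → Ω → WithCemetery E
  /-- the filtration -/
  filt : Filtration ℝ≥0 mΩ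
  /-- the law of the process started at a point -/
  P : WithCemetery E → Measure Ω
  isProbabilityMeasure : ∀ x, IsProbabilityMeasure (P x)
  absorbed : ∀ (ω : Ω) (s t : ℝ≥0), s ≤ t → X s ω = cemetery E → X t ω = cemetery E
  adapted : ∀ t, Measurable[filt t] (X t)
  measurable_transition : ∀ (t : ℝ≥0) (B : Set E), MeasurableSet B →
    Measurable fun x : E => P (Sum.inl x) (X t ⁻¹' (Sum.inl '' B))
  normal : ∀ x, P x {ω | X 0 ω = x} = 1
  /-- joint measurability with respect to the `σ`-algebra generated by `X` -/
  measurable_natural :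
    @Measurable (ℝ≥0 × Ω) (WithCemetery E)
      (@Prod.instMeasurableSpace ℝ≥0 Ω inferInstance
        (⨆ t : ℝ≥0, MeasurableSpace.comap (X t) inferInstance))
      inferInstance (fun p => X p.1 p.2)

namespace NormalProcess

variable {E : Type u} [MeasurableSpace E] {Ω : Type v} [mΩ : MeasurableSpace Ω]

/-- The strong Markov property: for every stopping time `τ`, every time `s` and every Borel set `B`
of `E_Δ`, `P_x (X_{τ+s} ∈ B | 𝒢_τ) = P_{X_τ} (X_s ∈ B)` on `{τ < ∞}`, `P_x`-almost surely. The
identity between conditional probabilities is tested on the sets `A ∈ 𝒢_τ`. -/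
def StrongMarkov (𝕏 : NormalProcess E Ω) : Prop :=
  ∀ (τ : Ω → WithTop ℝ≥0) (hτ : IsStoppingTime 𝕏.filt τ) (x : WithCemetery E) (s : ℝ≥0)
    (B : Set (WithCemetery E)), MeasurableSet B →
    ∀ A : Set Ω, MeasurableSet[hτ.measurableSpace] A →
      𝕏.P x (A ∩ {ω | τ ω ≠ ⊤} ∩ {ω | 𝕏.X ((τ ω).untopD 0 + s) ω ∈ B}) =
        ∫⁻ ω in A ∩ {ω | τ ω ≠ ⊤}, 𝕏.P (𝕏.X ((τ ω).untopD 0) ω) (𝕏.X s ⁻¹' B) ∂(𝕏.P x)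

/-- A right Markov process: right continuous paths, a right continuous filtration and the strong
Markov property (the simple Markov property is the case of constant stopping times). -/
structure IsRightMarkov [TopologicalSpace E] (𝕏 : NormalProcess E Ω) : Prop where
  rightContinuous_paths : ∀ (ω : Ω) (t : ℝ≥0), ContinuousWithinAt (fun s => 𝕏.X s ω) (Ici t) t
  rightContinuous_filt : 𝕏.filt.IsRightContinuous
  strongMarkov : 𝕏.StrongMarkov

/-- The resolvent `R_α f (x) = E_x ∫_0^∞ e^{-α t} f (X_t) dt`, with the convention `f (Δ) = 0`. -/
noncomputable def resolvent (𝕏 : NormalProcess E Ω) (α : ℝ) (f : E → ℝ≥0∞) (x : E) : ℝ≥0∞ :=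
  ∫⁻ ω, (∫⁻ t in Ici (0 : ℝ), ENNReal.ofReal (Real.exp (-(α * t))) * Sum.elim f (fun _ => 0) (𝕏.X t.toNNReal ω))
    ∂(𝕏.P (Sum.inl x))

/-- The triple `(𝕏, 𝓤, m)` has the compactness property; `m` is a set function on `E`, and a
property holds `m`-a.e. if it holds off a set `N` with `m N = 0`. -/
def HasCompactnessPropertyWith (𝕏 : NormalProcess E Ω) (𝓤 : Set (E → ℝ≥0∞))
    (m : Set E → ℝ≥0∞) : Prop :=
  ∀ u : ℕ → E → ℝ≥0∞, (∀ n, u n ∈ 𝓤) →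
    ∃ Λ : Set ℝ, Λ ⊆ Ioi 0 ∧ ¬ BddAbove Λ ∧
      ∃ φ : ℕ → ℕ, StrictMono φ ∧ ∀ α ∈ Λ, ∃ N : Set E, m N = 0 ∧
        ∀ x ∉ N, ∃ l : ℝ≥0∞, l ≠ ∞ ∧
          Tendsto (fun n => 𝕏.resolvent α (u (φ n)) x) atTop (𝓝 l)

/-- The pair `(𝕏, 𝓤)` has the compactness property: the set function is the counting measure. -/
def HasCompactnessProperty (𝕏 : NormalProcess E Ω) (𝓤 : Set (E → ℝ≥0∞)) : Prop :=
  𝕏.HasCompactnessPropertyWith 𝓤 fun A => (A.encard : ℝ≥0∞)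

/-- `m` is a reference measure: it is `σ`-finite and, for some `α > 0`, `R_α(x, ·) ≪ m` for every
`x ∈ E`, where `R_α(x, B) = R_α 1_B (x)`. -/
def IsReferenceMeasure (𝕏 : NormalProcess E Ω) (m : Measure E) : Prop :=
  SigmaFinite m ∧ ∃ α : ℝ, 0 < α ∧ ∀ x : E, ∀ B : Set E, MeasurableSet B → m B = 0 →
    𝕏.resolvent α (B.indicator 1) x = 0

/-- Meyer's hypothesis (L): there is a reference measure. -/
def MeyerHypothesisL (𝕏 : NormalProcess E Ω) : Prop :=
  ∃ m : Measure E, 𝕏.IsReferenceMeasure m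

end NormalProcess

/-- `𝓑₁`: the Borel functions `u` on `E` with `0 ≤ u ≤ 1`. -/
def borelUnitBall (E : Type u) [MeasurableSpace E] : Set (E → ℝ≥0∞) :=
  {u | Measurable u ∧ ∀ x, u x ≤ 1}

/-! For fixed x the potential measures R_α(x,·) have the same null sets for all α. Under (L) a
single finite measure m therefore dominates all of them, and convergence of R_α u_n(x) is weak-*
sequential compactness of the unit ball of L^∞(m), tested on the densities dR_α(x,·)/dm
(`exists_subseq_tendsto_lintegral`). One subsequence serves every α and x.

Conversely, let E be analytic and suppose that no s-finite measure dominates every R_1(x,·).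
Parametrize E by Baire space, under a finer Polish topology making the masses of the sets of a
countable generating algebra continuous. Deleting all open sets of parameters on which domination
holds up to an error ε leaves a nonempty closed set, each nonempty relatively open part of which is
non-dominated by the same margin (`exists_forall_isFreeFamily`). A Cantor scheme on it yields sets
W_n such that every 0-1 sequence a is realized by a point x: R_1(x,W_n) exceeds a constant when a_n
= 1 and is below 1/(n+1) when a_n = 0 (`exists_independent_sets`). Given any subsequence, an a
alternating along it destroys convergence; `potential_anti` and `potential_one_le` carry this from α
= 1 to large α. -/

/-! ### Exponential weights on the half-line -/

/-- The measure `e^{-α t} dt` on `[0, ∞)`. -/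
noncomputable def expWeight (α : ℝ) : Measure ℝ :=
  (volume.restrict (Ici (0 : ℝ))).withDensity fun t => ENNReal.ofReal (Real.exp (-(α * t)))

theorem measurable_expWeight_density (α : ℝ) :
    Measurable fun t : ℝ => ENNReal.ofReal (Real.exp (-(α * t))) := by fun_prop

theorem isFiniteMeasure_expWeight {α : ℝ} (hα : 0 < α) : IsFiniteMeasure (expWeight α) := by
  refine isFiniteMeasure_withDensity_ofReal ?_
  have h : IntegrableOn (fun t : ℝ => Real.exp (-α * t)) (Ici 0) := by
    rw [integrableOn_Ici_iff_integrableOn_Ioi]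
    exact exp_neg_integrableOn_Ioi 0 hα
  simpa [neg_mul] using h.2

theorem sFinite_expWeight (α : ℝ) : SFinite (expWeight α) := by
  unfold expWeight; infer_instance

theorem lintegral_expWeight (α : ℝ) {f : ℝ → ℝ≥0∞} (hf : Measurable f) :
    ∫⁻ t, f t ∂(expWeight α) =
      ∫⁻ t in Ici (0 : ℝ), ENNReal.ofReal (Real.exp (-(α * t))) * f t :=
  lintegral_withDensity_eq_lintegral_mul _ (measurable_expWeight_density α) hf

theorem expWeight_absolutelyContinuous (α β : ℝ) : expWeight α ≪ expWeight β := by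
  refine (withDensity_absolutelyContinuous _ _).trans ?_
  refine withDensity_absolutelyContinuous' (measurable_expWeight_density β).aemeasurable ?_
  exact .of_forall fun t => by simp [Real.exp_pos]

/-- The weights `e^{-t}` are controlled by the weights `e^{-αt}` up to an arbitrarily small mass. -/
theorem expWeight_one_le {ε : ℝ≥0∞} (hε : ε ≠ 0) :
    ∃ T : ℝ, ∀ α : ℝ, 1 ≤ α → ∀ f : ℝ → ℝ≥0∞, Measurable f → (∀ t, f t ≤ 1) →
      ∫⁻ t, f t ∂(expWeight 1) ≤
        ENNReal.ofReal (Real.exp ((α - 1) * T)) * ∫⁻ t, f t ∂(expWeight α) + ε := by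
  have := isFiniteMeasure_expWeight one_pos
  have hlim : Tendsto (fun n : ℕ => expWeight 1 (Ioi (n : ℝ))) atTop (𝓝 0) := by
    have h := tendsto_measure_iInter_atTop (μ := expWeight 1) (s := fun n : ℕ => Ioi (n : ℝ))
      (fun n => measurableSet_Ioi.nullMeasurableSet)
      (fun a b hab => Ioi_subset_Ioi (by exact_mod_cast hab)) ⟨0, measure_ne_top _ _⟩
    have he : ⋂ n : ℕ, Ioi (n : ℝ) = ∅ := by
      ext x
      obtain ⟨n, hn⟩ := exists_nat_ge x
      simp only [mem_iInter, mem_Ioi, mem_empty_iff_false, iff_false, not_forall, not_lt]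
      exact ⟨n, hn⟩
    rwa [he, measure_empty] at h
  obtain ⟨n, hn⟩ := ((tendsto_order.1 hlim).2 ε hε.bot_lt).exists
  -- Up to time n, e^{-t} = e^{(α-1)t} e^{-αt} ≤ e^{(α-1)n} e^{-αt}; after n the mass of e^{-t} is
  -- below ε.
  refine ⟨n, fun α hα f hf hf1 => ?_⟩
  rw [← lintegral_add_compl f (measurableSet_Iic (a := (n : ℝ)))]
  gcongr
  · rw [expWeight, setLIntegral_withDensity_eq_setLIntegral_mul _ (measurable_expWeight_density 1)
      hf measurableSet_Iic, lintegral_expWeight α hf, ← lintegral_const_mul _ (by fun_prop)]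
    refine (setLIntegral_mono (by fun_prop) fun t ht => ?_).trans (setLIntegral_le_lintegral _ _)
    simp only [Pi.mul_apply]
    rw [← mul_assoc, ← ENNReal.ofReal_mul (Real.exp_pos _).le, ← Real.exp_add]
    gcongr
    have : (t : ℝ) ≤ n := ht
    nlinarith
  · calc ∫⁻ t in (Iic (n : ℝ))ᶜ, f t ∂(expWeight 1)
        ≤ ∫⁻ t in (Iic (n : ℝ))ᶜ, 1 ∂(expWeight 1) := lintegral_mono fun t => hf1 t
      _ = expWeight 1 (Ioi (n : ℝ)) := by simp
      _ ≤ ε := hn.le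

/-! ### Potential measures and their dependence on α -/

namespace NormalProcess

variable {E : Type u} [MeasurableSpace E] {Ω : Type v} [mΩ : MeasurableSpace Ω]

theorem measurable_path (𝕏 : NormalProcess E Ω) :
    Measurable fun p : Ω × ℝ => 𝕏.X p.2.toNNReal p.1 := by
  have hle : (⨆ t : ℝ≥0, MeasurableSpace.comap (𝕏.X t) inferInstance) ≤ mΩ :=
    iSup_le fun t => ((𝕏.adapted t).mono (𝕏.filt.le t) le_rfl).comap_le
  have h : Measurable fun p : ℝ≥0 × Ω => 𝕏.X p.1 p.2 :=
    𝕏.measurable_natural.mono (sup_le_sup le_rfl (MeasurableSpace.comap_mono hle)) le_rfl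
  exact h.comp ((measurable_real_toNNReal.comp measurable_snd).prodMk measurable_fst)

theorem measurable_X (𝕏 : NormalProcess E Ω) (t : ℝ≥0) : Measurable (𝕏.X t) :=
  (𝕏.adapted t).mono (𝕏.filt.le t) le_rfl

theorem measurable_elim_zero {f : E → ℝ≥0∞} (hf : Measurable f) :
    Measurable (Sum.elim f (fun _ => 0) : WithCemetery E → ℝ≥0∞) :=
  measurable_fun_sum hf measurable_const

theorem measurableEmbedding_inl :
    MeasurableEmbedding (Sum.inl : E → WithCemetery E) where
  injective := Sum.inl_injective
  measurable := measurable_inl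
  measurableSet_image' _ hs := hs.inl_image

theorem lintegral_comap_inl (μ : Measure (WithCemetery E)) {f : E → ℝ≥0∞} (hf : Measurable f) :
    ∫⁻ x, f x ∂(μ.comap Sum.inl) = ∫⁻ y, Sum.elim f (fun _ => 0) y ∂μ := by
  have hm := measurable_elim_zero hf
  calc ∫⁻ x, f x ∂(μ.comap Sum.inl)
      = ∫⁻ x, Sum.elim f (fun _ => 0) (Sum.inl x : WithCemetery E) ∂(μ.comap Sum.inl) := rfl
    _ = ∫⁻ y, Sum.elim f (fun _ => 0) y ∂(μ.restrict (range Sum.inl)) := by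
        rw [← measurableEmbedding_inl.map_comap, lintegral_map hm measurable_inl]
    _ = ∫⁻ y, Sum.elim f (fun _ => 0) y ∂μ := by
        rw [← lintegral_indicator measurableSet_range_inl]
        refine lintegral_congr fun y => ?_
        rcases y with y | y <;> simp [indicator]

/-- The potential measure `R_α(x, ·)`. -/
noncomputable def potential (𝕏 : NormalProcess E Ω) (α : ℝ) (x : E) : Measure E :=
  (((𝕏.P (Sum.inl x)).prod (expWeight α)).map
    fun p : Ω × ℝ => 𝕏.X p.2.toNNReal p.1).comap Sum.inl

theorem isFiniteMeasure_potential (𝕏 : NormalProcess E Ω) {α : ℝ} (hα : 0 < α) (x : E) :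
    IsFiniteMeasure (𝕏.potential α x) := by
  have := isFiniteMeasure_expWeight hα
  have := 𝕏.isProbabilityMeasure (Sum.inl x)
  refine ⟨?_⟩
  rw [potential, measurableEmbedding_inl.comap_apply]
  exact measure_lt_top _ _

theorem lintegral_potential (𝕏 : NormalProcess E Ω) (α : ℝ) (x : E) {f : E → ℝ≥0∞}
    (hf : Measurable f) :
    ∫⁻ y, f y ∂(𝕏.potential α x) = ∫⁻ ω, ∫⁻ t, Sum.elim f (fun _ => 0) (𝕏.X t.toNNReal ω)
      ∂(expWeight α) ∂(𝕏.P (Sum.inl x)) := by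
  have := sFinite_expWeight α
  have := 𝕏.isProbabilityMeasure (Sum.inl x)
  have hm := measurable_elim_zero hf
  rw [potential, lintegral_comap_inl _ hf, lintegral_map hm 𝕏.measurable_path,
    lintegral_prod _ (hm.fun_comp 𝕏.measurable_path).aemeasurable]

theorem resolvent_eq_lintegral (𝕏 : NormalProcess E Ω) (α : ℝ) {f : E → ℝ≥0∞}
    (hf : Measurable f) (x : E) : 𝕏.resolvent α f x = ∫⁻ y, f y ∂(𝕏.potential α x) := by
  rw [lintegral_potential _ _ _ hf, resolvent]
  refine lintegral_congr fun ω => ?_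
  rw [lintegral_expWeight]
  exact (measurable_elim_zero hf).comp (𝕏.measurable_path.comp measurable_prodMk_left)

theorem resolvent_indicator (𝕏 : NormalProcess E Ω) (α : ℝ) (x : E) {B : Set E}
    (hB : MeasurableSet B) : 𝕏.resolvent α (B.indicator 1) x = 𝕏.potential α x B := by
  rw [resolvent_eq_lintegral _ _ (measurable_one.indicator hB), lintegral_indicator_one hB]

theorem potential_absolutelyContinuous (𝕏 : NormalProcess E Ω) (α β : ℝ) (x : E) :
    𝕏.potential α x ≪ 𝕏.potential β x := by
  have := sFinite_expWeight α
  have := sFinite_expWeight β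
  refine fun B hB => ?_
  rw [potential, measurableEmbedding_inl.comap_apply] at hB ⊢
  exact ((Measure.AbsolutelyContinuous.rfl.prod (expWeight_absolutelyContinuous α β)).map
    𝕏.measurable_path) hB

/-- The bound is uniform in x and B, so for fixed α ≥ 1 sets whose R_α-mass tends to 0 cannot keep
R_1-mass bounded away from 0. -/
theorem potential_one_le (𝕏 : NormalProcess E Ω) {ε : ℝ≥0∞} (hε : ε ≠ 0) :
    ∃ T : ℝ, ∀ α : ℝ, 1 ≤ α → ∀ (x : E) (B : Set E), MeasurableSet B →
      𝕏.potential 1 x B ≤ ENNReal.ofReal (Real.exp ((α - 1) * T)) * 𝕏.potential α x B + ε := by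
  obtain ⟨T, hT⟩ := expWeight_one_le hε
  refine ⟨T, fun α hα x B hB => ?_⟩
  have hind : Measurable (B.indicator (1 : E → ℝ≥0∞)) := measurable_one.indicator hB
  have hle : ∀ y : WithCemetery E, Sum.elim (B.indicator (1 : E → ℝ≥0∞)) (fun _ => 0) y ≤ 1 := by
    rintro (y | y)
    · exact indicator_apply_le' (fun _ => le_rfl) fun _ => zero_le_one
    · exact zero_le_one
  have hm := (measurable_elim_zero hind).fun_comp 𝕏.measurable_path
  have := 𝕏.isProbabilityMeasure (Sum.inl x)
  have := sFinite_expWeight α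
  rw [← lintegral_indicator_one hB, ← lintegral_indicator_one hB,
    lintegral_potential _ _ _ hind, lintegral_potential _ _ _ hind,
    ← lintegral_const_mul _ hm.lintegral_prod_right']
  calc _ ≤ ∫⁻ ω, _ + ε ∂(𝕏.P (Sum.inl x)) := lintegral_mono fun ω => hT α hα _
          (hm.comp measurable_prodMk_left) fun t => hle _
    _ = _ := by rw [lintegral_add_right _ measurable_const]; simp

end NormalProcess

/-! ### Monotonicity in α and measurability in the starting point -/

namespace NormalProcess

variable {E : Type u} [MeasurableSpace E] {Ω : Type v} [mΩ : MeasurableSpace Ω]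

theorem potential_anti (𝕏 : NormalProcess E Ω) {α β : ℝ} (h : α ≤ β) (x : E) (B : Set E) :
    𝕏.potential β x B ≤ 𝕏.potential α x B := by
  have := sFinite_expWeight α
  have := sFinite_expWeight β
  have hle : expWeight β ≤ expWeight α := by
    unfold expWeight
    refine withDensity_mono ((ae_restrict_mem measurableSet_Ici).mono fun t ht => ?_)
    have : (0 : ℝ) ≤ t := ht
    beta_reduce
    gcongr
  rw [potential, potential, measurableEmbedding_inl.comap_apply,
    measurableEmbedding_inl.comap_apply]
  exact Measure.map_mono (Measure.prod_mono le_rfl hle) 𝕏.measurable_path _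

theorem measurable_transition_lintegral (𝕏 : NormalProcess E Ω) (t : ℝ≥0) {f : E → ℝ≥0∞}
    (hf : Measurable f) :
    Measurable fun x : E => ∫⁻ ω, Sum.elim f (fun _ => 0) (𝕏.X t ω) ∂(𝕏.P (Sum.inl x)) := by
  have h : Measurable fun x : E => ((𝕏.P (Sum.inl x)).map (𝕏.X t)).comap Sum.inl := by
    refine Measure.measurable_of_measurable_coe _ fun B hB => ?_
    have := 𝕏.measurable_transition t B hB
    simpa only [measurableEmbedding_inl.comap_apply, Measure.map_apply (𝕏.measurable_X t)
      (measurableEmbedding_inl.measurableSet_image.2 hB)] using this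
  have h2 := (Measure.measurable_lintegral hf).comp h
  simpa only [Function.comp_def, lintegral_comap_inl _ hf,
    lintegral_map (measurable_elim_zero hf) (𝕏.measurable_X t)] using h2

/-- A function of `(t, x)` that is right continuous in `t` and measurable in `x` is measurable. -/
theorem measurable_uncurry_of_rightContinuous {f : ℝ → E → ℝ≥0∞}
    (hc : ∀ x t, ContinuousWithinAt (fun s => f s x) (Ioi t) t) (hm : ∀ t, Measurable (f t)) :
    Measurable fun p : ℝ × E => f p.1 p.2 := by
  -- The least multiple of 1/(n+1) strictly above t: countably many values, decreasing to t from the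
  -- right up to an error 1/(n+1).
  let a : ℕ → ℝ → ℝ := fun n t => ((⌊(n + 1 : ℝ) * t⌋ : ℝ) + 1) / (n + 1)
  have ha : ∀ t, Tendsto (fun n => a n t) atTop (𝓝[>] t) := fun t => by
    have hpos : ∀ n : ℕ, (0 : ℝ) < n + 1 := fun n => by positivity
    have hgt : ∀ n, t < a n t := fun n => by
      rw [lt_div_iff₀ (hpos n), mul_comm]; exact Int.lt_floor_add_one _
    have hle : ∀ n, a n t ≤ t + 1 / ((n : ℝ) + 1) := fun n => by
      have h1 : (t + 1 / ((n : ℝ) + 1)) * (n + 1) = (n + 1) * t + 1 := by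
        have := (hpos n).ne'
        field_simp
      rw [div_le_iff₀ (hpos n), h1]
      gcongr
      exact Int.floor_le _
    refine tendsto_nhdsWithin_iff.2 ⟨?_, .of_forall hgt⟩
    refine tendsto_of_tendsto_of_tendsto_of_le_of_le tendsto_const_nhds ?_ (fun n => (hgt n).le) hle
    simpa using tendsto_one_div_add_atTop_nhds_zero_nat.const_add t
  refine measurable_of_tendsto_metrizable (f := fun n (p : ℝ × E) => f (a n p.1) p.2)
    (fun n => ?_) (tendsto_pi_nhds.2 fun p => (hc p.2 p.1).tendsto.comp (ha p.1))
  have h1 : Measurable fun q : ℤ × E => f (((q.1 : ℝ) + 1) / (n + 1)) q.2 :=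
    measurable_from_prod_countable_right fun k => hm (((k : ℝ) + 1) / (n + 1))
  have h2 : Measurable fun p : ℝ × E => (⌊(n + 1 : ℝ) * p.1⌋, p.2) :=
    (Int.measurable_floor.comp (measurable_fst.const_mul _)).prodMk measurable_snd
  exact h1.comp h2

variable [TopologicalSpace E]

theorem IsRightMarkov.continuousWithinAt_transition [OpensMeasurableSpace E]
    {𝕏 : NormalProcess E Ω} (h : 𝕏.IsRightMarkov)
    (f : BoundedContinuousFunction E ℝ≥0) (x : E) (t : ℝ) :
    ContinuousWithinAt (fun s : ℝ => ∫⁻ ω, Sum.elim (fun y => (f y : ℝ≥0∞)) (fun _ => 0)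
      (𝕏.X s.toNNReal ω) ∂(𝕏.P (Sum.inl x))) (Ioi t) t := by
  have := 𝕏.isProbabilityMeasure (Sum.inl x)
  have hf : Measurable fun y => (f y : ℝ≥0∞) := f.continuous.measurable.coe_nnreal_ennreal
  have hcont : Continuous (Sum.elim (fun y => (f y : ℝ≥0∞)) (fun _ => 0) :
      WithCemetery E → ℝ≥0∞) :=
    (ENNReal.continuous_coe.comp f.continuous).sumElim continuous_const
  obtain ⟨C, hC⟩ : ∃ C : ℝ≥0, ∀ y, f y ≤ C :=
    ⟨nndist f 0, fun y => by simpa [NNReal.nndist_zero_eq_val'] using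
      BoundedContinuousFunction.nndist_coe_le_nndist (f := f) (g := 0) y⟩
  refine tendsto_lintegral_filter_of_dominated_convergence (fun _ => (C : ℝ≥0∞))
    (.of_forall fun s => (measurable_elim_zero hf).comp (𝕏.measurable_X _))
    (.of_forall fun s => .of_forall fun ω => ?_) (by simp) (.of_forall fun ω => ?_)
  · rcases 𝕏.X s.toNNReal ω with y | y
    · simpa using hC y
    · simp
  · refine hcont.continuousAt.tendsto.comp ?_
    refine (h.rightContinuous_paths ω t.toNNReal).tendsto.comp
      (tendsto_nhdsWithin_iff.2 ⟨?_, ?_⟩)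
    · exact (continuous_real_toNNReal.tendsto t).mono_left nhdsWithin_le_nhds
    · exact eventually_nhdsWithin_of_forall fun s hs => Real.toNNReal_le_toNNReal (le_of_lt hs)

/-- For bounded continuous f, E_x f(X_t) is right continuous in t and measurable in x, hence jointly
measurable and integrable out in t. Closed sets follow by approximating their indicators by
continuous functions, and Borel sets by a π-system argument. -/
theorem IsRightMarkov.measurable_potential [TopologicalSpace.MetrizableSpace E] [BorelSpace E]
    {𝕏 : NormalProcess E Ω} (h : 𝕏.IsRightMarkov) {α : ℝ} (hα : 0 < α) :
    Measurable (𝕏.potential α) := by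
  let := TopologicalSpace.metrizableSpaceMetric E
  have := fun x => 𝕏.isFiniteMeasure_potential hα x
  have := isFiniteMeasure_expWeight hα
  have key : ∀ f : BoundedContinuousFunction E ℝ≥0,
      Measurable fun x => ∫⁻ y, f y ∂(𝕏.potential α x) := fun f => by
    have hf : Measurable fun y => (f y : ℝ≥0∞) := f.continuous.measurable.coe_nnreal_ennreal
    have hswap : ∀ x, ∫⁻ y, f y ∂(𝕏.potential α x) = ∫⁻ t, ∫⁻ ω, Sum.elim
        (fun y => (f y : ℝ≥0∞)) (fun _ => 0) (𝕏.X t.toNNReal ω) ∂(𝕏.P (Sum.inl x))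
        ∂(expWeight α) := fun x => by
      have := 𝕏.isProbabilityMeasure (Sum.inl x)
      rw [lintegral_potential _ _ _ hf, lintegral_lintegral_swap]
      exact ((measurable_elim_zero hf).comp 𝕏.measurable_path).aemeasurable
    simp_rw [hswap]
    exact (measurable_uncurry_of_rightContinuous (fun x t => h.continuousWithinAt_transition f x t)
      fun t => 𝕏.measurable_transition_lintegral _ hf).lintegral_prod_left'
  refine Measurable.measure_of_isPiSystem (S := {s | IsClosed s}) ?_ isPiSystem_isClosed
    (fun s hs => ?_) ?_
  · rw [BorelSpace.measurable_eq (α := E), borel_eq_generateFrom_isClosed]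
  · refine measurable_of_tendsto_metrizable (fun n => key (hs.apprSeq n)) (tendsto_pi_nhds.2 fun x => ?_)
    exact HasOuterApproxClosed.tendsto_lintegral_apprSeq hs _
  · have := key 1
    simpa using this

end NormalProcess

/-! ### Weak sequential compactness -/

section

theorem cauchySeq_of_forall_approx {a : ℕ → ℝ}
    (h : ∀ ε > 0, ∃ b : ℕ → ℝ, CauchySeq b ∧ ∀ n, |a n - b n| ≤ ε) : CauchySeq a := by
  refine Metric.cauchySeq_iff'.2 fun ε hε => ?_
  obtain ⟨b, hb, hab⟩ := h (ε / 4) (by positivity)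
  obtain ⟨N, hN⟩ := Metric.cauchySeq_iff'.1 hb (ε / 4) (by positivity)
  refine ⟨N, fun n hn => ?_⟩
  have h1 := abs_le.1 (hab n)
  have h2 := abs_le.1 (hab N)
  have h3 := abs_lt.1 (Real.dist_eq _ _ ▸ hN n hn)
  rw [Real.dist_eq, abs_lt]
  constructor <;> linarith

/-- A bounded sequence in a Hilbert space has a weakly Cauchy subsequence. -/
theorem exists_subseq_cauchySeq_inner {H : Type*} [NormedAddCommGroup H] [InnerProductSpace ℝ H]
    [CompleteSpace H] {w : ℕ → H} {C : ℝ} (hC : ∀ n, ‖w n‖ ≤ C) :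
    ∃ φ : ℕ → ℕ, StrictMono φ ∧ ∀ y : H, CauchySeq fun n => inner ℝ y (w (φ n)) := by
  have hC0 : 0 ≤ C := (norm_nonneg _).trans (hC 0)
  have hK : IsCompact (univ.pi fun _ : ℕ => Icc (-(C * C)) (C * C)) :=
    isCompact_univ_pi fun _ => isCompact_Icc
  -- Only the countably many test vectors w k need a diagonal argument: their closed span contains
  -- the sequence, and its orthogonal complement tests to 0.
  obtain ⟨l, -, φ, hφ, hl⟩ := hK.tendsto_subseq (x := fun n k => inner ℝ (w k) (w n))
    fun n => mem_univ_pi.2 fun k => abs_le.1 <| (abs_real_inner_le_norm _ _).trans <|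
      mul_le_mul (hC k) (hC n) (norm_nonneg _) hC0
  refine ⟨φ, hφ, ?_⟩
  have hspan : ∀ y ∈ Submodule.span ℝ (range w), CauchySeq fun n => inner ℝ y (w (φ n)) := by
    intro y hy
    induction hy using Submodule.span_induction with
    | mem y hy =>
      obtain ⟨k, rfl⟩ := hy
      exact (tendsto_pi_nhds.1 hl k).cauchySeq
    | zero => simpa using cauchySeq_const (0 : ℝ)
    | add y z _ _ hy hz => simp only [inner_add_left]; exact hy.add hz
    | smul c y _ hy =>
      obtain ⟨b, hb⟩ := cauchySeq_tendsto_of_complete hy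
      simpa only [real_inner_smul_left] using (hb.const_mul c).cauchySeq
  have hclos : ∀ y ∈ (Submodule.span ℝ (range w)).topologicalClosure,
      CauchySeq fun n => inner ℝ y (w (φ n)) := by
    intro y hy
    refine cauchySeq_of_forall_approx fun ε hε => ?_
    obtain ⟨z, hz, hyz⟩ := Metric.mem_closure_iff.1 hy (ε / (C + 1)) (by positivity)
    refine ⟨_, hspan z hz, fun n => ?_⟩
    rw [← inner_sub_left]
    refine (abs_real_inner_le_norm _ _).trans ?_
    rw [dist_eq_norm, lt_div_iff₀ (by positivity)] at hyz
    refine le_trans ?_ hyz.le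
    gcongr
    linarith [hC (φ n)]
  intro y
  obtain ⟨y₁, h₁, y₂, h₂, rfl⟩ :=
    (Submodule.span ℝ (range w)).topologicalClosure.exists_add_mem_mem_orthogonal y
  have hz : ∀ n, inner ℝ y₂ (w (φ n)) = 0 := fun n =>
    Submodule.inner_left_of_mem_orthogonal
      (Submodule.le_topologicalClosure _ (Submodule.subset_span (mem_range_self _))) h₂
  simpa only [inner_add_left, hz, add_zero] using hclos y₁ h₁

variable {E : Type*} [MeasurableSpace E]

/-- Sequential weak-* compactness of the unit ball of `L^∞` of a finite measure. -/
theorem exists_subseq_tendsto_lintegral (m : Measure E) [IsFiniteMeasure m]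
    {f : ℕ → E → ℝ≥0∞} (hf : ∀ n, Measurable (f n)) (hf1 : ∀ n x, f n x ≤ 1) :
    ∃ φ : ℕ → ℕ, StrictMono φ ∧ ∀ ν : Measure E, IsFiniteMeasure ν → ν ≪ m →
      ∃ l : ℝ≥0∞, l ≠ ∞ ∧ Tendsto (fun n => ∫⁻ x, f (φ n) x ∂ν) atTop (𝓝 l) := by
  have hm : ∀ n, Measurable fun x => (f n x).toReal := fun n => (hf n).ennreal_toReal
  have hb : ∀ n x, ‖(f n x).toReal‖ ≤ 1 := fun n x => by
    rw [Real.norm_of_nonneg ENNReal.toReal_nonneg]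
    exact ENNReal.toReal_le_of_le_ofReal zero_le_one (by simpa using hf1 n x)
  have hLp : ∀ n, MemLp (fun x => (f n x).toReal) 2 m := fun n =>
    MemLp.of_bound (hm n).aestronglyMeasurable 1 (.of_forall (hb n))
  obtain ⟨φ, hφ, hc⟩ := exists_subseq_cauchySeq_inner (w := fun n => (hLp n).toLp)
    (C := measureUnivNNReal m ^ (2 : ℝ≥0∞).toReal⁻¹ * 1) fun n => by
      have := Lp.norm_le_of_ae_bound (f := (hLp n).toLp) zero_le_one
        ((hLp n).coeFn_toLp.mono fun x hx => by rw [hx]; exact hb n x)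
      simpa using this
  refine ⟨φ, hφ, fun ν hν hνm => ?_⟩
  have hint : ∀ g : E → ℝ, Integrable g m → ∀ n,
      Integrable (fun x => g x * (f (φ n) x).toReal) m := fun g hg n =>
    hg.mul_bdd (hm _).aestronglyMeasurable (.of_forall (hb _))
  have key : ∀ g : E → ℝ, Integrable g m →
      CauchySeq fun n => ∫ x, g x * (f (φ n) x).toReal ∂m := by
    -- Indicators lie in L², where weak convergence is available; since the f n are bounded by 1,
    -- the Cauchy property passes to L¹ limits of g.
    refine fun g hg => Integrable.induction (P := fun g : E → ℝ => CauchySeq fun n : ℕ =>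
      ∫ x, g x * (f (φ n) x).toReal ∂m) ?_ ?_ ?_ ?_ hg
    · intro c s hs hμs
      have h := hc (indicatorConstLp 2 hs hμs.ne 1)
      simp only [L2.inner_indicatorConstLp_one] at h
      obtain ⟨b, hb⟩ := cauchySeq_tendsto_of_complete h
      have h2 := (hb.const_mul c).cauchySeq
      have e : ∀ n, ∫ x, s.indicator (fun _ => c) x * (f (φ n) x).toReal ∂m =
          c * ∫ x in s, ((hLp (φ n)).toLp _ : Lp ℝ 2 m) x ∂m := fun n => by
        rw [setIntegral_congr_ae hs ((hLp (φ n)).coeFn_toLp.mono fun x hx _ => hx),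
          ← integral_indicator hs, ← integral_const_mul]
        congr 1 with x
        by_cases hx : x ∈ s <;> simp [hx]
      simpa only [e] using h2
    · intro g₁ g₂ _ h₁ h₂ hc₁ hc₂
      simp only [Pi.add_apply, add_mul, integral_add (hint _ h₁ _) (hint _ h₂ _)]
      exact hc₁.add hc₂
    · refine isClosed_of_closure_subset fun g hg => cauchySeq_of_forall_approx fun ε hε => ?_
      obtain ⟨g', hg', hd⟩ := Metric.mem_closure_iff.1 hg ε hε
      refine ⟨_, hg', fun n => ?_⟩
      rw [← integral_sub (hint _ (L1.integrable_coeFn g) n) (hint _ (L1.integrable_coeFn g') n)]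
      refine (abs_integral_le_integral_abs).trans (le_trans ?_ hd.le)
      rw [L1.dist_eq_integral_dist]
      refine integral_mono_of_nonneg (.of_forall fun x => abs_nonneg _) ?_ (.of_forall fun x => ?_)
      · exact ((L1.integrable_coeFn g).sub (L1.integrable_coeFn g')).norm.congr
          (.of_forall fun x => by simp [Real.dist_eq])
      · simp only [← sub_mul, abs_mul, Real.dist_eq]
        exact mul_le_of_le_one_right (abs_nonneg _) (hb _ _)
    · intro g₁ g₂ he _ h
      have e : ∀ n, ∫ x, g₁ x * (f (φ n) x).toReal ∂m = ∫ x, g₂ x * (f (φ n) x).toReal ∂m :=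
        fun n => integral_congr_ae (he.mono fun x hx => by simp only [hx])
      simpa only [e] using h
  obtain ⟨b, hb'⟩ := cauchySeq_tendsto_of_complete
    (key (fun x => (ν.rnDeriv m x).toReal) Measure.integrable_toReal_rnDeriv)
  refine ⟨ENNReal.ofReal b, ENNReal.ofReal_ne_top, ?_⟩
  convert (ENNReal.continuous_ofReal.tendsto b).comp hb' using 2 with n
  have h1 : ∫⁻ x, f (φ n) x ∂ν ≠ ∞ := by
    refine ne_top_of_le_ne_top (measure_ne_top ν univ) ?_
    calc ∫⁻ x, f (φ n) x ∂ν ≤ ∫⁻ _, 1 ∂ν := lintegral_mono fun x => hf1 _ x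
      _ = ν univ := by simp
  have h2 := integral_rnDeriv_smul hνm (f := fun x => (f (φ n) x).toReal)
  simp only [smul_eq_mul] at h2
  rw [Function.comp_apply, h2, integral_toReal (hf _).aemeasurable
    (.of_forall fun x => (hf1 _ x).trans_lt ENNReal.one_lt_top), ENNReal.ofReal_toReal h1]

end

/-! ### Non-dominated families and independent sets -/

section

variable {E Z : Type*} [MeasurableSpace E]

/-- The family `R z`, `z ∈ S`, is `ε`-free if for every s-finite measure `μ` some `R z` charges a
`μ`-null set with mass more than `ε`. -/
def IsFreeFamily (R : Z → Measure E) (ε : ℝ≥0∞) (S : Set Z) : Prop :=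
  ∀ μ : Measure E, SFinite μ → ∃ z ∈ S, ∃ N, MeasurableSet N ∧ μ N = 0 ∧ ε < R z N

theorem IsFreeFamily.mono {R : Z → Measure E} {ε : ℝ≥0∞} {S T : Set Z}
    (h : IsFreeFamily R ε S) (hST : S ⊆ T) : IsFreeFamily R ε T := fun μ hμ =>
  let ⟨z, hz, hN⟩ := h μ hμ
  ⟨z, hST hz, hN⟩

theorem IsFreeFamily.nonempty {R : Z → Measure E} {ε : ℝ≥0∞} {S : Set Z}
    (h : IsFreeFamily R ε S) : S.Nonempty :=
  let ⟨z, hz, _⟩ := h 0 inferInstance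
  ⟨z, hz⟩

/-- A countable union of non-free sets is not free. -/
theorem not_isFreeFamily_biUnion {R : Z → Measure E} {ε : ℝ≥0∞} {𝒯 : Set (Set Z)}
    (h𝒯 : 𝒯.Countable) (h : ∀ S ∈ 𝒯, ¬ IsFreeFamily R ε S) : ¬ IsFreeFamily R ε (⋃₀ 𝒯) := by
  have := h𝒯.to_subtype
  have h' : ∀ S : 𝒯, ∃ μ : Measure E, SFinite μ ∧
      ∀ z ∈ S.1, ∀ N, MeasurableSet N → μ N = 0 → R z N ≤ ε := fun S => by
    simpa [IsFreeFamily] using h S.1 S.2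
  choose μ hμ hle using h'
  intro hf
  obtain ⟨z, ⟨S, hS, hz⟩, N, hN, h0, hlt⟩ := hf (Measure.sum μ) inferInstance
  rw [Measure.sum_apply _ hN, ENNReal.tsum_eq_zero] at h0
  exact hlt.not_ge (hle ⟨S, hS⟩ z hz N hN (h0 _))

/-- If no s-finite measure dominates the family `R`, then after removing an open set of
parameters it becomes uniformly non-dominated on every nonempty open set. -/
theorem exists_forall_isFreeFamily [TopologicalSpace Z] [SecondCountableTopology Z]
    {R : Z → Measure E} (h : ∀ μ : Measure E, SFinite μ → ∃ z, ¬ R z ≪ μ) :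
    ∃ ε : ℝ≥0∞, ε ≠ 0 ∧ ε ≠ ∞ ∧ ∃ C : Set Z, IsClosed C ∧ C.Nonempty ∧
      ∀ U, IsOpen U → (U ∩ C).Nonempty → IsFreeFamily R ε (U ∩ C) := by
  -- Otherwise each error 1/(n+1) has its own measure, and the sum of these would dominate the whole
  -- family.
  obtain ⟨n, hn⟩ : ∃ n : ℕ, IsFreeFamily R ((n : ℝ≥0∞) + 1)⁻¹ univ := by
    by_contra! hcon
    have h' : ∀ n : ℕ, ∃ μ : Measure E, SFinite μ ∧
        ∀ z N, MeasurableSet N → μ N = 0 → R z N ≤ ((n : ℝ≥0∞) + 1)⁻¹ := fun n => by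
      simpa [IsFreeFamily] using hcon n
    choose μ hμ hle using h'
    obtain ⟨z, hz⟩ := h (Measure.sum μ) inferInstance
    refine hz (Measure.AbsolutelyContinuous.mk fun N hN h0 => ?_)
    rw [Measure.sum_apply _ hN, ENNReal.tsum_eq_zero] at h0
    have hlim : Tendsto (fun n : ℕ => ((n : ℝ≥0∞) + 1)⁻¹) atTop (𝓝 0) := by
      simpa using (tendsto_add_atTop_iff_nat 1).2 ENNReal.tendsto_inv_nat_nhds_zero
    exact le_antisymm (ge_of_tendsto' hlim fun n => hle n z N hN (h0 n)) zero_le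
  refine ⟨((n : ℝ≥0∞) + 1)⁻¹, by simp, by simp, ?_⟩
  generalize ((n : ℝ≥0∞) + 1)⁻¹ = ε at hn
  let 𝒮 : Set (Set Z) := {U | IsOpen U ∧ ¬ IsFreeFamily R ε U}
  obtain ⟨𝒯, h𝒯, h𝒯𝒮, hU⟩ := TopologicalSpace.isOpen_sUnion_countable 𝒮 fun U hU => hU.1
  have hO : ¬ IsFreeFamily R ε (⋃₀ 𝒮) := by
    rw [← hU]
    exact not_isFreeFamily_biUnion h𝒯 fun S hS => (h𝒯𝒮 hS).2
  refine ⟨(⋃₀ 𝒮)ᶜ, (isOpen_sUnion fun U hU => hU.1).isClosed_compl, ?_, fun U hUo hUn => ?_⟩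
  · rw [nonempty_compl]
    rintro he
    exact hO (he ▸ hn)
  · by_contra hfree
    obtain ⟨z, hz, hzC⟩ := hUn
    have hUfree : IsFreeFamily R ε U := by
      by_contra hc
      exact hzC ⟨U, ⟨hUo, hc⟩, hz⟩
    -- By second countability the union of all non-free open sets is itself non-free, so adding it
    -- to a non-free U ∩ C would make U non-free.
    refine not_isFreeFamily_biUnion (𝒯 := {U ∩ (⋃₀ 𝒮)ᶜ, ⋃₀ 𝒮}) (by simp) ?_
      (hUfree.mono fun y hy => ?_)
    · rintro S (rfl | rfl)
      exacts [hfree, hO]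
    · by_cases hyS : y ∈ ⋃₀ 𝒮
      · exact ⟨_, Or.inr rfl, hyS⟩
      · exact ⟨_, Or.inl rfl, hy, hyS⟩

/-- Simultaneous separation: finitely many free sets contain points at which a single set of a
generating algebra has measure below `δ`, and points at which it has measure above `ε`. -/
theorem exists_separating_set {𝒜 : Set (Set E)} (h𝒜 : IsSetAlgebra 𝒜)
    (hgen : ‹MeasurableSpace E› = MeasurableSpace.generateFrom 𝒜) {R : Z → Measure E}
    (hR : ∀ z, IsFiniteMeasure (R z)) {ε δ : ℝ≥0∞} (hε : ε ≠ 0) (hε' : ε ≠ ∞) (hδ : δ ≠ 0)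
    {ι : Type*} (s : Finset ι) {V : ι → Set Z} (hV : ∀ i, IsFreeFamily R (2 * ε) (V i)) :
    ∃ A ∈ 𝒜, ∃ z : ι → Bool → Z, (∀ i b, z i b ∈ V i) ∧
      ∀ i ∈ s, R (z i false) A < δ ∧ ε < R (z i true) A := by
  choose z₀ hz₀ using fun i => (hV i).nonempty
  let μ₀ : Measure E := ∑ i ∈ s, R (z₀ i)
  -- Freeness is tested against the sum of the measures at the points z₀ i: all the N i are null for
  -- that sum, so their union is a single set negligible at every z₀ i and heavy at every z₁ i.
  choose z₁ hz₁ N hNm hN0 hNε using fun i => hV i μ₀ inferInstance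
  let μ : Measure E := μ₀ + ∑ i ∈ s, R (z₁ i)
  have hle₀ : ∀ i ∈ s, R (z₀ i) ≤ μ₀ := fun i hi => by
    exact Finset.single_le_sum (f := fun i => R (z₀ i)) (fun _ _ => Measure.zero_le _) hi
  have hle₁ : ∀ i ∈ s, R (z₁ i) ≤ μ := fun i hi =>
    (Finset.single_le_sum (f := fun i => R (z₁ i)) (fun _ _ => Measure.zero_le _) hi).trans
      (Measure.le_add_left le_rfl)
  let M : Set E := ⋃ i ∈ s, N i
  have hM : MeasurableSet M := s.measurableSet_biUnion fun i _ => hNm i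
  have hM0 : μ₀ M = 0 := (measure_biUnion_null_iff s.countable_toSet).2 fun i _ => hN0 i
  obtain ⟨r, hr0, hr⟩ : ∃ r : ℝ, 0 < r ∧ ENNReal.ofReal r ≤ min ε δ := by
    have hne : min ε δ ≠ ∞ := ne_top_of_le_ne_top hε' (min_le_left _ _)
    exact ⟨(min ε δ).toReal, ENNReal.toReal_pos (by simp [hε, hδ]) hne, ENNReal.ofReal_toReal_le⟩
  -- Replacing M by a set of the algebra costs at most min ε δ; this is why freeness is assumed at
  -- level 2ε and only ε is kept.
  obtain ⟨A, hA, hAM⟩ := (Measure.MeasureDense.of_generateFrom_isSetAlgebra_finite μ h𝒜 hgen).approx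
    M hM (measure_ne_top _ _) r hr0
  have hAM' := hAM.trans_le hr
  refine ⟨A, hA, fun i b => cond b (z₁ i) (z₀ i), fun i b => ?_, fun i hi => ⟨?_, ?_⟩⟩
  · cases b
    exacts [hz₀ i, hz₁ i]
  · calc R (z₀ i) A ≤ μ₀ A := hle₀ i hi A
      _ ≤ μ₀ (M ∪ symmDiff M A) := measure_mono fun x hx => by
          by_cases hxM : x ∈ M
          · exact Or.inl hxM
          · exact Or.inr (Or.inr ⟨hx, hxM⟩)
      _ ≤ μ₀ M + μ₀ (symmDiff M A) := measure_union_le _ _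
      _ ≤ 0 + μ (symmDiff M A) := by
          gcongr
          · exact hM0.le
          · exact Measure.le_add_right le_rfl
      _ < δ := by rw [zero_add]; exact hAM'.trans_le (min_le_right _ _)
  · have h1 : 2 * ε < R (z₁ i) A + ε := calc
      2 * ε < R (z₁ i) (N i) := hNε i
      _ ≤ R (z₁ i) (A ∪ symmDiff M A) := measure_mono fun x hx => by
          by_cases hxA : x ∈ A
          · exact Or.inl hxA
          · exact Or.inr (Or.inl ⟨mem_biUnion hi hx, hxA⟩)
      _ ≤ R (z₁ i) A + R (z₁ i) (symmDiff M A) := measure_union_le _ _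
      _ ≤ R (z₁ i) A + ε := by
          gcongr
          exact (hle₁ i hi _).trans (hAM'.le.trans (min_le_left _ _))
    rw [two_mul] at h1
    exact lt_of_add_lt_add_right h1

/-- The splitting step of the construction of a Cantor scheme. -/
theorem exists_split [MetricSpace Z] {𝒜 : Set (Set E)} (h𝒜 : IsSetAlgebra 𝒜)
    (hgen : ‹MeasurableSpace E› = MeasurableSpace.generateFrom 𝒜) {R : Z → Measure E}
    (hR : ∀ z, IsFiniteMeasure (R z)) (hcont : ∀ A ∈ 𝒜, Continuous fun z => R z A)
    {ε : ℝ≥0∞} (hε : ε ≠ 0) (hε' : ε ≠ ∞) {C : Set Z}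
    (hC : ∀ U, IsOpen U → (U ∩ C).Nonempty → IsFreeFamily R (2 * ε) (U ∩ C))
    {δ : ℝ≥0∞} (hδ : δ ≠ 0) {ι : Type*} (s : Set ι) (hs : s.Finite) (U : ι → Set Z)
    (hU : ∀ i, IsOpen (U i) ∧ (U i ∩ C).Nonempty) :
    ∃ A ∈ 𝒜, ∃ V : ι → Bool → Set Z, (∀ i b, IsOpen (V i b) ∧ (V i b ∩ C).Nonempty) ∧
      (∀ i b, closure (V i b) ⊆ U i) ∧ (∀ i b, Metric.ediam (V i b) ≤ δ) ∧
      ∀ i ∈ s, (∀ z ∈ V i false, R z A < δ) ∧ ∀ z ∈ V i true, ε < R z A := by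
  obtain ⟨A, hA, z, hz, hzA⟩ := exists_separating_set h𝒜 hgen hR hε hε' hδ hs.toFinset
    fun i => hC (U i) (hU i).1 (hU i).2
  -- Both strict inequalities persist near z i b, because the mass of A is continuous in the
  -- parameter.
  let G : ι → Bool → Set Z := fun i b =>
    {y | i ∈ s → (b = false → R y A < δ) ∧ (b = true → ε < R y A)}
  have hG : ∀ i b, G i b ∈ 𝓝 (z i b) := fun i b => by
    by_cases hi : i ∈ s
    · obtain ⟨h0, h1⟩ := hzA i (hs.mem_toFinset.2 hi)
      cases b
      · filter_upwards [(hcont A hA).continuousAt.eventually_lt_const h0] with y hy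
        exact fun _ => ⟨fun _ => hy, fun hb => absurd hb (by decide)⟩
      · filter_upwards [(hcont A hA).continuousAt.eventually_const_lt h1] with y hy
        exact fun _ => ⟨fun hb => absurd hb (by decide), fun _ => hy⟩
    · exact Filter.mem_of_superset univ_mem fun y _ hi' => absurd hi' hi
  have hr : ∀ i b, ∃ r : ℝ, 0 < r ∧ ENNReal.ofReal (2 * r) ≤ δ ∧
      Metric.closedBall (z i b) r ⊆ U i ∩ G i b := fun i b => by
    obtain ⟨r, hr, hsub⟩ := Metric.nhds_basis_closedBall.mem_iff.1
      (inter_mem ((hU i).1.mem_nhds (hz i b).1) (hG i b))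
    obtain ⟨q, hq0, hq⟩ : ∃ q : ℝ, 0 < q ∧ ENNReal.ofReal (2 * q) ≤ δ := by
      have hne : min δ 1 ≠ ∞ := ne_top_of_le_ne_top ENNReal.one_ne_top (min_le_right _ _)
      refine ⟨(min δ 1).toReal / 2, half_pos (ENNReal.toReal_pos (by simp [hδ]) hne), ?_⟩
      rw [mul_div_cancel₀ _ two_ne_zero]
      exact ENNReal.ofReal_toReal_le.trans (min_le_left _ _)
    refine ⟨min r q, lt_min hr hq0, le_trans (by gcongr; exact min_le_right _ _) hq,
      (Metric.closedBall_subset_closedBall (min_le_left _ _)).trans hsub⟩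
  choose r hr0 hrδ hrsub using hr
  refine ⟨A, hA, fun i b => Metric.ball (z i b) (r i b), fun i b => ⟨Metric.isOpen_ball,
    z i b, Metric.mem_ball_self (hr0 i b), (hz i b).2⟩, fun i b =>
    Metric.closure_ball_subset_closedBall.trans ((hrsub i b).trans inter_subset_left),
    fun i b => ?_, fun i hi => ⟨fun y hy => ?_, fun y hy => ?_⟩⟩
  · change Metric.ediam (Metric.ball (z i b) (r i b)) ≤ δ
    rw [← Metric.eball_ofReal]
    refine Metric.ediam_eball_le.trans (le_trans ?_ (hrδ i b))
    simp [ENNReal.ofReal_mul zero_le_two]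
  · exact ((hrsub i false (Metric.ball_subset_closedBall hy)).2 hi).1 rfl
  · exact ((hrsub i true (Metric.ball_subset_closedBall hy)).2 hi).2 rfl

/-- A non-dominated continuously parametrized family of finite measures admits an independent
sequence of sets. -/
theorem exists_independent_sets [TopologicalSpace Z] [PolishSpace Z] {𝒜 : Set (Set E)}
    (h𝒜 : IsSetAlgebra 𝒜) (hgen : ‹MeasurableSpace E› = MeasurableSpace.generateFrom 𝒜)
    {R : Z → Measure E} (hR : ∀ z, IsFiniteMeasure (R z))
    (hcont : ∀ A ∈ 𝒜, Continuous fun z => R z A)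
    (h : ∀ μ : Measure E, SFinite μ → ∃ z, ¬ R z ≪ μ) :
    ∃ ε : ℝ≥0∞, ε ≠ 0 ∧ ∃ W : ℕ → Set E, (∀ n, W n ∈ 𝒜) ∧ ∀ a : ℕ → Bool, ∃ z, ∀ n,
      (a n = true → ε < R z (W n)) ∧ (a n = false → R z (W n) < ((n : ℝ≥0∞) + 1)⁻¹) := by
  let := TopologicalSpace.upgradeIsCompletelyMetrizable Z
  obtain ⟨ε₂, h0, htop, C, -, hCne, hC⟩ := exists_forall_isFreeFamily h
  obtain ⟨ε, rfl⟩ : ∃ ε, ε₂ = 2 * ε := ⟨ε₂ / 2, (ENNReal.mul_div_cancel two_ne_zero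
    ENNReal.ofNat_ne_top).symm⟩
  have hε : ε ≠ 0 := right_ne_zero_of_mul h0
  have hε' : ε ≠ ∞ := fun he => htop (by simp [he])
  refine ⟨ε, hε, ?_⟩
  -- The set A must be common to all 2^n words of length n, so that the independent sets depend on
  -- the level alone. Words of other lengths carry no separation condition.
  have step : ∀ (n : ℕ) (U : {U : List Bool → Set Z // ∀ i, IsOpen (U i) ∧ (U i ∩ C).Nonempty}),
      ∃ A ∈ 𝒜, ∃ V : List Bool → Bool → Set Z, (∀ i b, IsOpen (V i b) ∧ (V i b ∩ C).Nonempty) ∧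
      (∀ i b, closure (V i b) ⊆ U.1 i) ∧
      (∀ i b, Metric.ediam (V i b) ≤ ((n : ℝ≥0∞) + 1)⁻¹) ∧
      ∀ i ∈ {l : List Bool | l.length = n}, (∀ z ∈ V i false, R z A < ((n : ℝ≥0∞) + 1)⁻¹) ∧
        ∀ z ∈ V i true, ε < R z A := fun n U =>
    exists_split h𝒜 hgen hR hcont hε hε' hC (by simp) _ (List.finite_length_eq Bool n) U.1 U.2
  choose A hA V hV hcl hdiam hsep using step
  let next : ∀ n : ℕ, {U : List Bool → Set Z // ∀ i, IsOpen (U i) ∧ (U i ∩ C).Nonempty} →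
      {U : List Bool → Set Z // ∀ i, IsOpen (U i) ∧ (U i ∩ C).Nonempty} := fun n U =>
    ⟨fun l => match l with
      -- A filler value: stage n + 1 is only read at words of length n + 1. Words grow at the head,
      -- as in `PiNat.res`.
      | [] => univ
      | b :: l => V n U l b, fun l => by
        cases l with
        | nil => exact ⟨isOpen_univ, by simpa using hCne⟩
        | cons b l => exact hV n U l b⟩
  let D : ℕ → {U : List Bool → Set Z // ∀ i, IsOpen (U i) ∧ (U i ∩ C).Nonempty} := fun n =>
    Nat.rec ⟨fun _ => univ, fun _ => ⟨isOpen_univ, by simpa using hCne⟩⟩ next n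
  let S : List Bool → Set Z := fun l => (D l.length).1 l
  have hS : ∀ l b, S (b :: l) = V l.length (D l.length) l b := fun l b => rfl
  have hne : ∀ l, (S l).Nonempty := fun l => ((D l.length).2 l).2.mono inter_subset_left
  have hanti : CantorScheme.ClosureAntitone S := fun l b => by
    rw [hS]; exact hcl _ _ _ _
  have hvan : CantorScheme.VanishingDiam S := fun x => by
    rw [← tendsto_add_atTop_iff_nat 1]
    have hlim : Tendsto (fun n : ℕ => ((n : ℝ≥0∞) + 1)⁻¹) atTop (𝓝 0) := by
      simpa using (tendsto_add_atTop_iff_nat 1).2 ENNReal.tendsto_inv_nat_nhds_zero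
    refine tendsto_of_tendsto_of_tendsto_of_le_of_le tendsto_const_nhds hlim (fun n => zero_le)
      fun n => ?_
    simp only [PiNat.res_succ, hS]
    simpa using hdiam (PiNat.res x n).length (D (PiNat.res x n).length) (PiNat.res x n) (x n)
  have huniv := hanti.map_of_vanishingDiam hvan hne
  refine ⟨fun n => A n (D n), fun n => hA _ _, fun a => ?_⟩
  have ha : a ∈ (CantorScheme.inducedMap S).1 := huniv ▸ mem_univ a
  refine ⟨(CantorScheme.inducedMap S).2 ⟨a, ha⟩, fun n => ?_⟩
  have hmem := CantorScheme.map_mem (A := S) ⟨a, ha⟩ (n + 1)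
  simp only [PiNat.res_succ, hS, PiNat.res_length] at hmem
  have := hsep n (D n) (PiNat.res a n) (PiNat.res_length _ _)
  refine ⟨fun h => this.2 _ (h ▸ hmem), fun h => this.1 _ (h ▸ hmem)⟩

end

/-! ### The two implications -/

namespace NormalProcess

variable {E : Type u} [MeasurableSpace E] {Ω : Type v} [mΩ : MeasurableSpace Ω]

theorem MeyerHypothesisL.hasCompactnessProperty {𝕏 : NormalProcess E Ω}
    (h : 𝕏.MeyerHypothesisL) : 𝕏.HasCompactnessProperty (borelUnitBall E) := by
  obtain ⟨m, hm, α, hα, hac⟩ := h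
  intro f hf
  obtain ⟨φ, hφ, hconv⟩ := exists_subseq_tendsto_lintegral m.toFinite
    (fun n => (hf n).1) (fun n => (hf n).2)
  refine ⟨Ioi 0, subset_rfl, not_bddAbove_Ioi 0, φ, hφ, fun β hβ => ⟨∅, by simp, fun x _ => ?_⟩⟩
  have hdom : 𝕏.potential α x ≪ m := Measure.AbsolutelyContinuous.mk fun B hB h0 => by
    rw [← 𝕏.resolvent_indicator α x hB]
    exact hac x B hB h0
  simp only [𝕏.resolvent_eq_lintegral β (hf _).1 x]
  exact hconv _ (𝕏.isFiniteMeasure_potential hβ x)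
    (((𝕏.potential_absolutelyContinuous β α x).trans hdom).trans (absolutelyContinuous_toFinite m))

/-- An s-finite dominating measure has the same null sets as the finite measure `μ.toFinite`, which
would be a reference measure. -/
theorem exists_not_absolutelyContinuous_potential {𝕏 : NormalProcess E Ω}
    (h : ¬ 𝕏.MeyerHypothesisL) (μ : Measure E) [SFinite μ] :
    ∃ x, ¬ 𝕏.potential 1 x ≪ μ := by
  by_contra! hac
  refine h ⟨μ.toFinite, inferInstance, 1, one_pos, fun x B hB h0 => ?_⟩
  rw [𝕏.resolvent_indicator 1 x hB]
  exact (hac x) (toFinite_apply_eq_zero_iff.1 h0)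

variable [TopologicalSpace E] [TopologicalSpace.MetrizableSpace E] [BorelSpace E]

theorem IsRightMarkov.exists_independent_sets {𝕏 : NormalProcess E Ω} (h𝕏 : 𝕏.IsRightMarkov)
    (hE : AnalyticSet (univ : Set E)) (hL : ¬ 𝕏.MeyerHypothesisL) :
    ∃ ε : ℝ≥0∞, ε ≠ 0 ∧ ∃ W : ℕ → Set E, (∀ n, MeasurableSet (W n)) ∧ ∀ a : ℕ → Bool, ∃ x, ∀ n,
      (a n = true → ε < 𝕏.potential 1 x (W n)) ∧
      (a n = false → 𝕏.potential 1 x (W n) < ((n : ℝ≥0∞) + 1)⁻¹) := by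
  have hdom := exists_not_absolutelyContinuous_potential hL
  rw [AnalyticSet] at hE
  obtain hE | ⟨g, hg, hsurj⟩ := hE
  · obtain ⟨x, -⟩ := hdom 0
    exact absurd (mem_univ x) (hE ▸ notMem_empty x)
  rw [range_eq_univ] at hsurj
  let := TopologicalSpace.metrizableSpaceMetric E
  have : TopologicalSpace.SeparableSpace E :=
    hsurj.denseRange.separableSpace hg
  have : SecondCountableTopology E := UniformSpace.secondCountable_of_separable E
  let 𝒜 : Set (Set E) := generateSetAlgebra (MeasurableSpace.countableGeneratingSet E)
  have h𝒜 : IsSetAlgebra 𝒜 := isSetAlgebra_generateSetAlgebra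
  have hgen : ‹MeasurableSpace E› = MeasurableSpace.generateFrom 𝒜 := by
    rw [generateFrom_generateSetAlgebra_eq,
      MeasurableSpace.generateFrom_countableGeneratingSet]
  have h𝒜m : ∀ A ∈ 𝒜, MeasurableSet A := fun A hA =>
    hgen ▸ MeasurableSpace.measurableSet_generateFrom hA
  have : Countable 𝒜 :=
    (countable_generateSetAlgebra MeasurableSpace.countable_countableGeneratingSet).to_subtype
  let F : (ℕ → ℕ) → 𝒜 → ℝ≥0∞ := fun z A => 𝕏.potential 1 (g z) A
  have hF : Measurable F := measurable_pi_lambda _ fun A =>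
    ((Measure.measurable_coe (h𝒜m A A.2)).comp (h𝕏.measurable_potential one_pos)).comp
      hg.measurable
  -- A finer Polish topology on Baire space makes F continuous; countability of 𝒜 keeps the target
  -- second countable.
  obtain ⟨t, -, htc, htp⟩ := hF.exists_continuous
  obtain ⟨ε, hε, W, hW, hz⟩ := @_root_.exists_independent_sets E (ℕ → ℕ) _ t htp 𝒜 h𝒜 hgen
    (fun z => 𝕏.potential 1 (g z)) (fun z => 𝕏.isFiniteMeasure_potential one_pos _)
    (fun A hA => (continuous_apply (⟨A, hA⟩ : 𝒜)).comp htc)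
    fun μ _ => by
      obtain ⟨x, hx⟩ := hdom μ
      obtain ⟨z, rfl⟩ := hsurj x
      exact ⟨z, hx⟩
  exact ⟨ε, hε, W, fun n => h𝒜m _ (hW n), fun a => let ⟨z, h⟩ := hz a; ⟨g z, h⟩⟩

theorem IsRightMarkov.meyerHypothesisL {𝕏 : NormalProcess E Ω} (h𝕏 : 𝕏.IsRightMarkov)
    (hE : AnalyticSet (univ : Set E)) (h : 𝕏.HasCompactnessProperty (borelUnitBall E)) :
    𝕏.MeyerHypothesisL := by
  classical
  by_contra hL
  obtain ⟨ε, hε, W, hW, hx⟩ := h𝕏.exists_independent_sets hE hL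
  obtain ⟨Λ, hΛ0, hΛ, φ, hφ, hconv⟩ := h (fun n => (W n).indicator 1) fun n =>
    ⟨measurable_one.indicator (hW n), fun x => indicator_apply_le' (fun _ => le_rfl)
      fun _ => zero_le_one⟩
  -- Unboundedness of Λ enters only here: α > 1 allows comparison with R_1 in both directions.
  obtain ⟨α, hα, hα1⟩ := not_bddAbove_iff.1 hΛ 1
  obtain ⟨N, hN, hlim⟩ := hconv α hα
  have hN' : N = ∅ := by simpa using hN
  -- The 0-1 sequence is chosen after φ, to be 1 exactly at the even-indexed terms of the
  -- subsequence.
  obtain ⟨x, hx⟩ := hx fun n => decide (∃ j, n = φ (2 * j))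
  obtain ⟨l, hl, hlim⟩ := hlim x (by simp [hN'])
  simp only [𝕏.resolvent_indicator α x (hW _)] at hlim
  have hodd : ∀ j, 𝕏.potential 1 x (W (φ (2 * j + 1))) < ((φ (2 * j + 1) : ℝ≥0∞) + 1)⁻¹ :=
    fun j => (hx _).2 <| decide_eq_false <| by
      rintro ⟨i, hi⟩
      have := hφ.injective hi
      omega
  have heven : ∀ j, ε < 𝕏.potential 1 x (W (φ (2 * j))) := fun j =>
    (hx _).1 <| decide_eq_true ⟨j, rfl⟩
  have hodd_lim : Tendsto (fun j => 𝕏.potential α x (W (φ (2 * j + 1)))) atTop (𝓝 l) :=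
    hlim.comp (tendsto_atTop_mono (fun j => by dsimp; omega) tendsto_id)
  have heven_lim : Tendsto (fun j => 𝕏.potential α x (W (φ (2 * j)))) atTop (𝓝 l) :=
    hlim.comp (tendsto_atTop_mono (fun j => by dsimp; omega) tendsto_id)
  have hl0 : l = 0 := by
    have hinv : Tendsto (fun n : ℕ => ((n : ℝ≥0∞) + 1)⁻¹) atTop (𝓝 0) := by
      simpa using (tendsto_add_atTop_iff_nat 1).2 ENNReal.tendsto_inv_nat_nhds_zero
    have hφ' : Tendsto (fun j => φ (2 * j + 1)) atTop atTop :=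
      hφ.tendsto_atTop.comp (tendsto_atTop_mono (fun j => by dsimp; omega) tendsto_id)
    exact le_antisymm (le_of_tendsto_of_tendsto' hodd_lim (hinv.comp hφ')
      fun j => (𝕏.potential_anti hα1.le x _).trans (hodd j).le) zero_le
  -- With error ε/2, the limit l = 0 along the even terms would force ε ≤ ε/2.
  obtain ⟨T, hT⟩ := 𝕏.potential_one_le (ENNReal.half_pos hε).ne'
  have hbound : ∀ j, ε ≤ ENNReal.ofReal (Real.exp ((α - 1) * T)) *
      𝕏.potential α x (W (φ (2 * j))) + ε / 2 := fun j =>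
    (heven j).le.trans (hT α hα1.le x _ (hW _))
  have hle := ge_of_tendsto' ((ENNReal.Tendsto.const_mul heven_lim
    (Or.inr ENNReal.ofReal_ne_top)).add_const (ε / 2)) hbound
  rw [hl0, mul_zero, zero_add] at hle
  exact (ENNReal.half_lt_self hε (heven 0).ne_top).not_ge hle

end NormalProcess

theorem mainTheorem4 {E : Type u} [TopologicalSpace E] [TopologicalSpace.MetrizableSpace E]
    [MeasurableSpace E] [BorelSpace E] (hE : IsRadonSpace E)
    {Ω : Type v} [MeasurableSpace Ω] (𝕏 : NormalProcess E Ω) (h𝕏 : 𝕏.IsRightMarkov) :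
    (AnalyticSet (Set.univ : Set E) →
      (𝕏.HasCompactnessProperty (borelUnitBall E) ↔ 𝕏.MeyerHypothesisL)) ∧
    (𝕏.MeyerHypothesisL → 𝕏.HasCompactnessProperty (borelUnitBall E)) :=
  ⟨fun hA => ⟨h𝕏.meyerHypothesisL hA, fun h => h.hasCompactnessProperty⟩,
    fun h => h.hasCompactnessProperty⟩
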